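/- Notation. For a function $h : 2^{\{A,B,C,D\}} \to \mathbb{R}$ and sets of variables $X, Y, Z \subseteq \{A,B,C,D\}$ put $I_h(Y;Z|X) = h(XY) + h(XZ) - h(XYZ) - h(X)$, where juxtaposition is union. For a conditional independence statement $\sigma = (Y;Z|X)$ put $h(\sigma) = I_h(Y;Z|X)$, with $(Y;Z) = (Y;Z|\emptyset)$, and for a finite set $\Sigma$ of such statements put $h(\Sigma) = \sum_{\sigma \in \Sigma} h(\sigma)$. Let $\Gamma_4^* \subseteq \mathbb{R}^{2^4}$ be the set of entropic functions, that is, of the functions $\alpha \mapsto H(X_\alpha)$, where $X_A, X_B, X_C, X_D$ are jointly distributed random variables with finite domains, $X_\alpha$ is the joint variable $(X_i : i \in \alpha)$ and $H$ is Shannon entropy (in bits), and let $\mathrm{cl}(\Gamma_4^*)$ be its topological closure. Theorem 5.1. Let $$\Sigma = \{(C;D|A),\ (C;D|B),\ (A;B),\ (B;C|D)\}, \qquad \tau = (C;D).$$ 1. The exact implication $\Sigma \Rightarrow \tau$ holds on $\mathrm{cl}(\Gamma_4^*)$: for every $h \in \mathrm{cl}(\Gamma_4^*)$, if $h(\Sigma)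 = 0$ then $h(\tau) = 0$. 2. The approximate implication fails on $\mathrm{cl}(\Gamma_4^*)$: there is no $\lambda \ge 0$ such that $h(\tau) \le \lambda\, h(\Sigma)$ for all $h \in \mathrm{cl}(\Gamma_4^*)$. 3. The failure is already witnessed by entropic functions. For $0 < \varepsilon < 1/2$ let $h_\varepsilon$ be the entropic function of the four binary variables $(A,B,C,D)$ that take the values $(0,0,0,0)$ and $(0,1,0,1)$ with probability $1/2 - \varepsilon$ each, and the values $(1,0,1,0)$ and $(1,1,0,0)$ with probability $\varepsilon$ each. Then for every real $\lambda$ there is $\varepsilon_0 \in (0, 1/2]$ such that for all $\varepsilon \in (0, \varepsilon_0)$ we have $h_\varepsilon \in \Gamma_4^*$ and $h_\varepsilon(\tau) > \lambda\, h_\varepsilon(\Sigma)$. -/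

import Mathlib

/-- Shannon entropy, in bits, of a probability mass function on a finite type:
`H(X) = ∑ x, p(x) log (1 / p(x))`, where a point of mass `0` contributes `0`. -/
noncomputable def shannonEntropy {T : Type*} [Fintype T] (p : T → ℝ) : ℝ :=
  ∑ x, p x * Real.logb 2 (1 / p x)

open Classical in
/-- The mass function of the joint variable `X_α = (X_i : i ∈ α)`, when `p` is the mass function of
`(X_1, …, X_n)` on the product of the domains. -/
noncomputable def marginal {n : ℕ} {D : Fin n → Type*} [∀ i, Fintype (D i)]
    (p : (∀ i, D i) → ℝ) (α : Finset (Fin n)) : (∀ i : α, D i) → ℝ :=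
  fun y => ∑ x with α.restrict x = y, p x

/-- The function `α ↦ H(X_α)` of jointly distributed variables with joint mass function `p`. -/
noncomputable def entropyVector {n : ℕ} {D : Fin n → Type*} [∀ i, Fintype (D i)]
    (p : (∀ i, D i) → ℝ) : Finset (Fin n) → ℝ :=
  fun α => shannonEntropy (marginal p α)

/-- `Γ*_n`, the set of entropic functions: the functions `α ↦ H(X_α)` of `n` jointly distributed
random variables with finite domains (`stdSimplex` is the set of probability mass functions). -/
def entropicFunctions (n : ℕ) : Set (Finset (Fin n) → ℝ) :=
  {h | ∃ (D : Fin n → Type) (_ : ∀ i, Fintype (D i)) (p : (∀ i, D i) → ℝ),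
    p ∈ stdSimplex ℝ (∀ i, D i) ∧ h = entropyVector p}

/-- The set of almost entropic functions: the topological closure of `Γ*_n` in `ℝ ^ (2 ^ n)`. -/
def almostEntropicFunctions (n : ℕ) : Set (Finset (Fin n) → ℝ) :=
  closure (entropicFunctions n)

/-- A conditional independence statement `(left ; right | given)` between sets of variables. -/
@[ext]
structure CondIndepStmt (n : ℕ) where
  left : Finset (Fin n)
  right : Finset (Fin n)
  given : Finset (Fin n)
deriving DecidableEq

/-- `h(σ) = I_h(B;C|A) = h(AB) + h(AC) - h(ABC) - h(A)` for `σ = (B;C|A)`. -/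
def CondIndepStmt.value {n : ℕ} (h : Finset (Fin n) → ℝ) (σ : CondIndepStmt n) : ℝ :=
  h (σ.given ∪ σ.left) + h (σ.given ∪ σ.right) - h (σ.given ∪ σ.left ∪ σ.right) - h σ.given

/-- `h(Σ) = ∑ σ ∈ Σ, h(σ)` for a finite set `Σ` of conditional independence statements. -/
def antecedentValue {n : ℕ} (h : Finset (Fin n) → ℝ) (S : Finset (CondIndepStmt n)) : ℝ :=
  ∑ σ ∈ S, σ.value h

/-- The exact implication `Σ ⇒ τ` holds in `K`. -/
def ExactImplication {n : ℕ} (K : Set (Finset (Fin n) → ℝ)) (S : Finset (CondIndepStmt n))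
    (τ : CondIndepStmt n) : Prop :=
  ∀ h ∈ K, antecedentValue h S = 0 → τ.value h = 0

/-- The `lam`-approximate implication `h(τ) ≤ lam * h(Σ)` holds in `K`. -/
def LambdaApproxImplication {n : ℕ} (K : Set (Finset (Fin n) → ℝ)) (lam : ℝ)
    (S : Finset (CondIndepStmt n)) (τ : CondIndepStmt n) : Prop :=
  ∀ h ∈ K, τ.value h ≤ lam * antecedentValue h S

/-- The approximate implication holds in `K`: some `lam ≥ 0` works for all of `K`. -/
def ApproxImplication {n : ℕ} (K : Set (Finset (Fin n) → ℝ)) (S : Finset (CondIndepStmt n))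
    (τ : CondIndepStmt n) : Prop :=
  ∃ lam : ℝ, 0 ≤ lam ∧ LambdaApproxImplication K lam S τ

/-- `Σ = {(C;D|A), (C;D|B), (A;B), (B;C|D)}`, the variables `A, B, C, D` being `0, 1, 2, 3`. -/
def sigmaABCD : Finset (CondIndepStmt 4) :=
  {⟨{2}, {3}, {0}⟩, ⟨{2}, {3}, {1}⟩, ⟨{0}, {1}, ∅⟩, ⟨{1}, {2}, {3}⟩}

/-- `τ = (C;D)`. -/
def tauABCD : CondIndepStmt 4 := ⟨{2}, {3}, ∅⟩

/-- The joint mass function of four binary variables `(A, B, C, D)` (the Kaced–Romashchenko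
distribution) with `p(0,0,0,0) = p(0,1,0,1) = 1/2 - ε` and `p(1,0,1,0) = p(1,1,0,0) = ε`. -/
noncomputable def kacedRomashchenko (ε : ℝ) : (Fin 4 → Fin 2) → ℝ := fun x =>
  if x = ![0, 0, 0, 0] then 1 / 2 - ε
  else if x = ![0, 1, 0, 1] then 1 / 2 - ε
  else if x = ![1, 0, 1, 0] then ε
  else if x = ![1, 1, 0, 0] then ε
  else 0

/-! The exact implication follows from a family of inequalities k·I(C;D) ≤ c_k·h(Σ) + I(B;D|C), one
for each natural k, valid for entropic functions. Being non-strict and continuous in h, they pass to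
the closure; when h(Σ) = 0 they bound every multiple of I(C;D) by a fixed number, so I(C;D) ≤ 0.

The family comes from iterating the copy lemma (`exists_copy`, `exists_smaller_infoBD`). Let B' be a
copy of B over CD, independent of AB given CD, and put B' in the place of D. Suppose h(Σ) = 0. Then
Σ holds for (A,B,C,B') as well, and I(C;B') = I(C;B) = I(C;D). Since A is independent of B and
separates C from B', I(B;B') ≤ I(B;B'|A) = H(B'|A) - H(B'|AB) ≤ H(B'|C) - H(B'|CD) = I(B;D|C). As
I(B;C|B') = 0, also I(B;B') = I(B;B'|C) + I(B;C), so the replacement lowers I(B;D|C) by at least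
I(C;D). In general every relation holds up to a multiple of h(Σ).

The ratio c_k/k cannot stay bounded: for the Kaced–Romashchenko distribution h(Σ) is O(ε²) while
I(C;D) is of order ε, which refutes every λ. -/

/-! ### Entropy of variables on a finite probability space -/

open Classical in
/-- The law of `F` under the mass function `p`. -/
noncomputable def mass {Ω T : Type*} [Fintype Ω] (p : Ω → ℝ) (F : Ω → T) : T → ℝ :=
  fun t => ∑ ω with F ω = t, p ω

/-- The entropy of `F` under the mass function `p`, in nats. -/
noncomputable def ent {Ω T : Type*} [Fintype Ω] (p : Ω → ℝ) (F : Ω → T) : ℝ :=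
  -∑ ω, p ω * Real.log (mass p F (F ω))

section Entropy

variable {Ω T R S : Type*} [Fintype Ω] {p : Ω → ℝ}

lemma mass_nonneg (hp : ∀ ω, 0 ≤ p ω) (F : Ω → T) (t : T) : 0 ≤ mass p F t :=
  Finset.sum_nonneg fun ω _ => hp ω

lemma le_mass (hp : ∀ ω, 0 ≤ p ω) (F : Ω → T) (ω : Ω) : p ω ≤ mass p F (F ω) := by
  classical
  exact Finset.single_le_sum (f := p) (fun ω _ => hp ω) (by simp)

lemma mass_eq_sum_ite [DecidableEq T] (p : Ω → ℝ) (F : Ω → T) (t : T) :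
    mass p F t = ∑ ω, if F ω = t then p ω else 0 := by
  rw [mass, Finset.sum_filter]
  congr!

lemma mass_id (p : Ω → ℝ) : mass p id = p := by
  classical
  ext ω
  simp [mass_eq_sum_ite]

lemma sum_mass_mul [Fintype T] (p : Ω → ℝ) (F : Ω → T) (φ : T → ℝ) :
    ∑ t, mass p F t * φ t = ∑ ω, p ω * φ (F ω) := by
  classical
  rw [← Finset.sum_fiberwise Finset.univ F (fun ω => p ω * φ (F ω))]
  refine Finset.sum_congr rfl fun t _ => ?_
  rw [mass, Finset.sum_mul]
  refine Finset.sum_congr (by congr) fun ω hω => ?_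
  simp only [Finset.mem_filter] at hω
  rw [hω.2]

lemma sum_mass [Fintype T] (p : Ω → ℝ) (F : Ω → T) : ∑ t, mass p F t = ∑ ω, p ω := by
  simpa using sum_mass_mul p F fun _ => 1

lemma mass_mass [Fintype T] (p : Ω → ℝ) (F : Ω → T) (g : T → R) :
    mass (mass p F) g = mass p (g ∘ F) := by
  classical
  ext r
  have := sum_mass_mul p F fun t => if g t = r then 1 else 0
  simp only [mul_ite, mul_one, mul_zero, ← Finset.sum_filter] at this
  simp only [mass, Function.comp] at this ⊢
  convert this

lemma ent_mass [Fintype T] (p : Ω → ℝ) (F : Ω → T) (g : T → R) :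
    ent (mass p F) g = ent p (g ∘ F) := by
  rw [ent, ent, mass_mass, sum_mass_mul p F fun t => Real.log (mass p (g ∘ F) (g t))]
  rfl

lemma shannonEntropy_mass [Fintype T] (p : Ω → ℝ) (F : Ω → T) :
    shannonEntropy (mass p F) = ent p F / Real.log 2 := by
  rw [shannonEntropy, sum_mass_mul p F fun t => Real.logb 2 (1 / mass p F t), ent, ← Finset.sum_neg_distrib,
    Finset.sum_div]
  refine Finset.sum_congr rfl fun ω _ => ?_
  rw [Real.logb, one_div, Real.log_inv]
  ring

/-- Entropy depends only on the partition that the variable induces on the support. -/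
lemma ent_congr {F : Ω → T} {G : Ω → R}
    (h : ∀ ω ω', p ω ≠ 0 → p ω' ≠ 0 → (F ω = F ω' ↔ G ω = G ω')) : ent p F = ent p G := by
  classical
  rw [ent, ent, neg_inj]
  refine Finset.sum_congr rfl fun ω _ => ?_
  by_cases h0 : p ω = 0
  · simp [h0]
  congr 2
  simp only [mass, Finset.sum_filter]
  refine Finset.sum_congr rfl fun ω' _ => ?_
  by_cases h1 : p ω' = 0
  · simp [h1]
  simp only [h ω' ω h1 h0]

lemma sum_mass_prod [Fintype R] (p : Ω → ℝ) (F : Ω → T) (G : Ω → R) (t : T) :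
    ∑ r, mass p (fun ω => (F ω, G ω)) (t, r) = mass p F t := by
  classical
  simp only [mass, Prod.mk.injEq, ← Finset.filter_filter]
  exact Finset.sum_fiberwise _ _ _

/-- Conditional mutual information is nonnegative. -/
lemma ent_submodular [Fintype T] [Fintype R] [Fintype S] (hp : ∀ ω, 0 ≤ p ω)
    (X : Ω → T) (Y : Ω → R) (Z : Ω → S) :
    ent p (fun ω => ((X ω, Y ω), Z ω)) + ent p Z ≤
      ent p (fun ω => (Z ω, X ω)) + ent p (fun ω => (Z ω, Y ω)) := by
  classical
  set U : Ω → (T × R) × S := fun ω => ((X ω, Y ω), Z ω)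
  set a := mass p fun ω => (Z ω, X ω)
  set b := mass p fun ω => (Z ω, Y ω)
  set c := mass p Z
  set d := mass p U
  have ha : ∀ t, 0 ≤ a t := mass_nonneg hp _
  have hb : ∀ t, 0 ≤ b t := mass_nonneg hp _
  have hc : ∀ t, 0 ≤ c t := mass_nonneg hp _
  have hd : ∀ t, 0 ≤ d t := mass_nonneg hp _
  -- The ratio compares the law that makes X and Y conditionally independent given Z with the true
  -- law; its mean is at most the total mass, and log t ≤ t - 1 then gives the claim.
  have key : ∑ ω, p ω * (a (Z ω, X ω) * b (Z ω, Y ω) / (c (Z ω) * d (U ω))) ≤ ∑ ω, p ω := by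
    rw [← sum_mass_mul p U
      fun u => a (u.2, u.1.1) * b (u.2, u.1.2) / (c u.2 * d u)]
    calc _ ≤ ∑ u : (T × R) × S, a (u.2, u.1.1) * b (u.2, u.1.2) / c u.2 := by
          refine Finset.sum_le_sum fun u _ => ?_
          have h0 : 0 ≤ a (u.2, u.1.1) * b (u.2, u.1.2) / c u.2 :=
            div_nonneg (mul_nonneg (ha _) (hb _)) (hc _)
          change d u * _ ≤ _
          rcases eq_or_ne (d u) 0 with hu | hu
          · simpa [hu] using h0
          · refine le_of_eq ?_
            rw [← div_div]
            field_simp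
      _ = ∑ z, c z := by
          rw [Fintype.sum_prod_type_right]
          refine Finset.sum_congr rfl fun z _ => ?_
          simp only [← Finset.sum_div, Fintype.sum_prod_type, ← Finset.mul_sum, ← Finset.sum_mul]
          simp only [a, b]
          rw [sum_mass_prod, sum_mass_prod]
          -- Values z of mass zero are covered too, since 0 * 0 / 0 = 0.
          exact mul_self_div_self _
      _ = _ := sum_mass p Z
  have main : ∑ ω, p ω * (Real.log (a (Z ω, X ω)) + Real.log (b (Z ω, Y ω))
      - Real.log (c (Z ω)) - Real.log (d (U ω))) ≤
      ∑ ω, p ω * (a (Z ω, X ω) * b (Z ω, Y ω) / (c (Z ω) * d (U ω)) - 1) := by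
    refine Finset.sum_le_sum fun ω _ => ?_
    rcases (hp ω).eq_or_lt with h0 | h0
    · simp [← h0]
    have h1 : 0 < a (Z ω, X ω) := h0.trans_le (le_mass hp (fun ω => (Z ω, X ω)) ω)
    have h2 : 0 < b (Z ω, Y ω) := h0.trans_le (le_mass hp (fun ω => (Z ω, Y ω)) ω)
    have h3 : 0 < c (Z ω) := h0.trans_le (le_mass hp Z ω)
    have h4 : 0 < d (U ω) := h0.trans_le (le_mass hp U ω)
    refine mul_le_mul_of_nonneg_left ?_ h0.le
    have := Real.log_le_sub_one_of_pos (x := a (Z ω, X ω) * b (Z ω, Y ω) / (c (Z ω) * d (U ω)))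
      (by positivity)
    rw [Real.log_div (by positivity) (by positivity), Real.log_mul h1.ne' h2.ne',
      Real.log_mul h3.ne' h4.ne'] at this
    linarith
  simp only [mul_sub, mul_add, mul_one, Finset.sum_sub_distrib, Finset.sum_add_distrib] at main
  simp only [ent]
  change -∑ ω, p ω * Real.log (d (U ω)) + -∑ ω, p ω * Real.log (c (Z ω)) ≤
    -∑ ω, p ω * Real.log (a (Z ω, X ω)) + -∑ ω, p ω * Real.log (b (Z ω, Y ω))
  linarith

/-! ### Conditionally independent copies -/

open Classical in
/-- Two copies of `p`, equal in `W` and conditionally independent given `W`. -/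
noncomputable def condDouble (p : Ω → ℝ) (W : Ω → T) : Ω × Ω → ℝ :=
  fun x => if W x.1 = W x.2 then p x.1 * p x.2 / mass p W (W x.1) else 0

lemma condDouble_nonneg (hp : ∀ ω, 0 ≤ p ω) (W : Ω → T) (x : Ω × Ω) : 0 ≤ condDouble p W x := by
  unfold condDouble
  split_ifs
  · exact div_nonneg (mul_nonneg (hp _) (hp _)) (mass_nonneg hp _ _)
  · exact le_rfl

lemma condDouble_swap (p : Ω → ℝ) (W : Ω → T) (x : Ω × Ω) :
    condDouble p W x.swap = condDouble p W x := by
  unfold condDouble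
  by_cases h : W x.1 = W x.2
  · simp [h, mul_comm]
  · simp [h, Ne.symm h]

lemma eq_of_condDouble_ne_zero {W : Ω → T} {x : Ω × Ω} (h : condDouble p W x ≠ 0) :
    W x.1 = W x.2 := by
  by_contra h'
  simp [condDouble, h'] at h

lemma sum_condDouble (hp : ∀ ω, 0 ≤ p ω) (W : Ω → T) (ω : Ω) :
    ∑ ω', condDouble p W (ω, ω') = p ω := by
  classical
  have : ∑ ω', condDouble p W (ω, ω') = p ω * mass p W (W ω) / mass p W (W ω) := by
    simp only [condDouble, mass, Finset.sum_filter, Finset.mul_sum, Finset.sum_div]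
    refine Finset.sum_congr rfl fun ω' _ => ?_
    simp only [eq_comm (a := W ω)]
    split_ifs <;> simp
  rw [this]
  rcases (hp ω).eq_or_lt with h0 | h0
  · simp [← h0]
  · exact mul_div_cancel_right₀ _ (h0.trans_le (le_mass hp W ω)).ne'

lemma mass_condDouble_fst (hp : ∀ ω, 0 ≤ p ω) (W : Ω → T) :
    mass (condDouble p W) Prod.fst = p := by
  classical
  ext ω
  rw [← sum_condDouble hp W ω, mass_eq_sum_ite, Fintype.sum_prod_type_right]
  simp

lemma mass_condDouble_snd (hp : ∀ ω, 0 ≤ p ω) (W : Ω → T) :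
    mass (condDouble p W) Prod.snd = p := by
  classical
  ext ω
  rw [← sum_condDouble hp W ω, mass_eq_sum_ite, Fintype.sum_prod_type]
  simp [← condDouble_swap p W (ω, _)]

lemma ent_condDouble_comp_fst (hp : ∀ ω, 0 ≤ p ω) (W : Ω → T) (F : Ω → R) :
    ent (condDouble p W) (F ∘ Prod.fst) = ent p F := by
  rw [← ent_mass, mass_condDouble_fst hp]

lemma ent_condDouble_comp_snd (hp : ∀ ω, 0 ≤ p ω) (W : Ω → T) (F : Ω → R) :
    ent (condDouble p W) (F ∘ Prod.snd) = ent p F := by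
  rw [← ent_mass, mass_condDouble_snd hp]

lemma sum_condDouble_eq (hp : ∀ ω, 0 ≤ p ω) (W : Ω → T) :
    ∑ x, condDouble p W x = ∑ ω, p ω := by
  rw [← sum_mass _ Prod.fst, mass_condDouble_fst hp]

/-- The two copies are conditionally independent given `W`. -/
lemma ent_condDouble_id (hp : ∀ ω, 0 ≤ p ω) (W : Ω → T) :
    ent (condDouble p W) id = 2 * ent p id - ent p W := by
  set q := condDouble p W
  have e1 : ∑ x, q x * Real.log (p x.1) = ∑ ω, p ω * Real.log (p ω) := by
    rw [← sum_mass_mul q Prod.fst fun ω => Real.log (p ω), mass_condDouble_fst hp]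
  have e2 : ∑ x, q x * Real.log (p x.2) = ∑ ω, p ω * Real.log (p ω) := by
    rw [← sum_mass_mul q Prod.snd fun ω => Real.log (p ω), mass_condDouble_snd hp]
  have e3 : ∑ x, q x * Real.log (mass p W (W x.1)) = ∑ ω, p ω * Real.log (mass p W (W ω)) := by
    rw [← sum_mass_mul q Prod.fst fun ω => Real.log (mass p W (W ω)), mass_condDouble_fst hp]
  have : ∑ x, q x * Real.log (q x) = ∑ x, (q x * Real.log (p x.1) + q x * Real.log (p x.2)
      - q x * Real.log (mass p W (W x.1))) := by
    refine Finset.sum_congr rfl fun x _ => ?_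
    by_cases h : q x = 0
    · simp [h]
    have hx : q x = p x.1 * p x.2 / mass p W (W x.1) := if_pos (eq_of_condDouble_ne_zero h)
    rw [← mul_add, ← mul_sub]
    congr 1
    rw [hx] at h ⊢
    simp only [div_eq_zero_iff, mul_eq_zero, not_or] at h
    rw [Real.log_div (mul_ne_zero h.1.1 h.1.2) h.2, Real.log_mul h.1.1 h.1.2]
  simp only [ent, mass_id, id]
  rw [this, Finset.sum_sub_distrib, Finset.sum_add_distrib, e1, e2, e3]
  ring

end Entropy


/-! ### Entropic functions and the copy lemma -/

lemma agree_iff {ι : Type*} {D : ι → Type*} {α : Finset ι} {x y : ∀ i, D i} :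
    α.restrict x = α.restrict y ↔ ∀ i ∈ α, x i = y i := by
  simp [funext_iff, Finset.restrict]

section Entropic

variable {n m : ℕ}

lemma entropyVector_eq {D : Fin n → Type*} [∀ i, Fintype (D i)] (p : (∀ i, D i) → ℝ)
    (α : Finset (Fin n)) : entropyVector p α = ent p α.restrict / Real.log 2 := by
  classical
  rw [← shannonEntropy_mass, entropyVector]
  congr 1
  ext y
  simp only [marginal, mass]
  congr!

/-- The entropy function of random variables on an arbitrary finite probability space. -/
lemma ent_mem_entropicFunctions {Ω : Type*} [Fintype Ω] {p : Ω → ℝ} (hp : p ∈ stdSimplex ℝ Ω)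
    {D : Fin n → Type} [∀ i, Fintype (D i)] (X : Ω → ∀ i, D i) :
    (fun α : Finset (Fin n) => ent p (α.restrict ∘ X) / Real.log 2) ∈ entropicFunctions n := by
  refine ⟨D, inferInstance, mass p X, ⟨mass_nonneg hp.1 _, (sum_mass p X).trans hp.2⟩, ?_⟩
  ext α
  rw [entropyVector_eq, ent_mass]

/-- Serves to select and reorder variables, in particular to discard D once its replacement has been
adjoined. -/
lemma entropic_comap {h : Finset (Fin n) → ℝ} (hh : h ∈ entropicFunctions n)
    (e : Fin m → Fin n) : (fun α => h (α.image e)) ∈ entropicFunctions m := by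
  obtain ⟨D, _, p, hp, rfl⟩ := hh
  convert ent_mem_entropicFunctions hp (D := fun i => D (e i)) (fun x i => x (e i)) using 2 with α
  rw [entropyVector_eq]
  congr 1
  refine ent_congr fun x y _ _ => ?_
  simp [agree_iff]

lemma entropic_submodular {h : Finset (Fin n) → ℝ} (hh : h ∈ entropicFunctions n)
    (α β : Finset (Fin n)) : h (α ∪ β) + h (α ∩ β) ≤ h α + h β := by
  obtain ⟨D, _, p, hp, rfl⟩ := hh
  simp only [entropyVector_eq, ← add_div]
  refine div_le_div_of_nonneg_right ?_ (Real.log_nonneg one_le_two)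
  have := ent_submodular (T := ∀ i : α, D i) (R := ∀ i : β, D i)
    (S := ∀ i : (α ∩ β : Finset (Fin n)), D i) hp.1 α.restrict β.restrict (α ∩ β).restrict
  refine (le_of_eq ?_).trans (this.trans (le_of_eq ?_)) <;> congr 1 <;>
  · apply ent_congr
    intro x y _ _
    simp only [agree_iff, Prod.mk.injEq, Finset.mem_union, Finset.mem_inter]
    grind

/-- The copy lemma: adjoin a copy of the variable `b` over the variables in `W`, conditionally
independent of all the variables given `W`. -/
lemma exists_copy {h : Finset (Fin n) → ℝ} (hh : h ∈ entropicFunctions n)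
    (W : Finset (Fin n)) (b : Fin n) :
    ∃ g ∈ entropicFunctions (n + 1), (∀ α, g (α.map Fin.castSuccEmb) = h α) ∧
      (∀ α ⊆ W, g (insert (Fin.last n) (α.map Fin.castSuccEmb)) = h (insert b α)) ∧
      h Finset.univ + h (insert b W) ≤ g Finset.univ + h W := by
  obtain ⟨D, _, p, hp, rfl⟩ := hh
  set e : Fin (n + 1) → Fin n := Fin.lastCases b id
  have transport (x y : ∀ i, D i) {i j : Fin n} (hij : i = j) : x i = y i ↔ x j = y j := by
    rw [hij]
  have e1 : e (Fin.last n) = b := by simp [e]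
  have e2 (i : Fin n) : e i.castSucc = i := by simp [e]
  set q := condDouble p W.restrict
  have hq : q ∈ stdSimplex ℝ _ :=
    ⟨condDouble_nonneg hp.1 _, (sum_condDouble_eq hp.1 _).trans hp.2⟩
  set X : (∀ i, D i) × (∀ i, D i) → ∀ i, D (e i) :=
    fun x i => (if i = Fin.last n then x.2 else x.1) (e i)
  have hX (x y) (α : Finset (Fin n)) : (α.map Fin.castSuccEmb).restrict (X x) =
      (α.map Fin.castSuccEmb).restrict (X y) ↔ α.restrict x.1 = α.restrict y.1 := by
    have (i : Fin n) : X x i.castSucc = X y i.castSucc ↔ x.1 i = y.1 i := by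
      simpa only [X, Fin.castSucc_ne_last, if_false] using transport _ _ (e2 i)
    simp [agree_iff, this]
  have hX' (x y) (α : Finset (Fin n)) : (insert (Fin.last n) (α.map Fin.castSuccEmb)).restrict (X x) =
      (insert (Fin.last n) (α.map Fin.castSuccEmb)).restrict (X y) ↔
      x.2 b = y.2 b ∧ α.restrict x.1 = α.restrict y.1 := by
    have : X x (Fin.last n) = X y (Fin.last n) ↔ x.2 b = y.2 b := by
      simpa only [X, if_true] using transport _ _ e1
    rw [← hX, agree_iff, agree_iff, Finset.forall_mem_insert, this]
  have hW {x} (hx : q x ≠ 0) : ∀ i ∈ W, x.1 i = x.2 i :=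
    agree_iff.1 (eq_of_condDouble_ne_zero hx)
  have copy (α) (hα : α ⊆ W) : ent q ((insert (Fin.last n) (α.map Fin.castSuccEmb)).restrict ∘ X) =
      ent p (insert b α).restrict := by
    rw [← ent_condDouble_comp_snd hp.1 W.restrict]
    refine ent_congr fun x y hx hy => ?_
    have h1 := hW hx
    have h2 := hW hy
    simp only [Function.comp, hX', agree_iff]
    grind
  refine ⟨_, ent_mem_entropicFunctions hq X, fun α => ?_, fun α hα => ?_, ?_⟩
  · rw [entropyVector_eq]
    congr 1
    rw [← ent_condDouble_comp_fst hp.1 W.restrict]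
    exact ent_congr fun x y _ _ => hX x y α
  · rw [entropyVector_eq, copy α hα]
  · simp only [entropyVector_eq, ← add_div]
    refine div_le_div_of_nonneg_right ?_ (Real.log_nonneg one_le_two)
    -- With ω₁, ω₂ the two copies of the whole system and b' the second copy of b, this is
    -- I(ω₁;ω₂|b'W) ≥ 0. Inserting H(ω₁ω₂) = 2H(ω) - H(W) turns it into a lower bound for H(ω₁b'),
    -- the entropy of all n + 1 variables.
    have key := ent_submodular hq.1 Prod.fst Prod.snd
      ((insert (Fin.last n) (W.map Fin.castSuccEmb)).restrict ∘ X)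
    rw [copy W le_rfl] at key
    have k1 : ent q (fun x => ((x.1, x.2),
        ((insert (Fin.last n) (W.map Fin.castSuccEmb)).restrict ∘ X) x)) = ent q id := by
      refine ent_congr fun x y _ _ => ?_
      simp only [id, Prod.ext_iff]
      exact ⟨fun h => h.1, fun h => ⟨h, congrArg (_ ∘ X) (Prod.ext h.1 h.2)⟩⟩
    have k2 : ent q (fun x => (((insert (Fin.last n) (W.map Fin.castSuccEmb)).restrict ∘ X) x,
        x.2)) = ent p id := by
      rw [← ent_condDouble_comp_snd hp.1 W.restrict]
      refine ent_congr fun x y hx hy => ?_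
      have h1 := hW hx
      have h2 := hW hy
      simp only [Prod.mk.injEq, Function.comp, hX', agree_iff, id]
      exact ⟨fun h => h.2, fun h => ⟨⟨by rw [h], fun i hi => by rw [h1 i hi, h2 i hi, h]⟩, h⟩⟩
    have k3 : ent q (fun x => (((insert (Fin.last n) (W.map Fin.castSuccEmb)).restrict ∘ X) x,
        x.1)) = ent q (Finset.univ.restrict ∘ X) := by
      have : (Finset.univ : Finset (Fin (n + 1))) =
          insert (Fin.last n) (Finset.univ.map Fin.castSuccEmb) := by
        ext i
        refine Fin.lastCases ?_ (fun j => ?_) i <;> simp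
      rw [this]
      refine ent_congr fun x y hx hy => ?_
      simp only [Prod.mk.injEq, Function.comp, hX']
      simp only [agree_iff]
      exact ⟨fun h => ⟨h.1.1, fun i _ => congrFun h.2 i⟩,
        fun h => ⟨⟨h.1, fun i _ => h.2 i (Finset.mem_univ i)⟩, funext fun i => h.2 i (Finset.mem_univ i)⟩⟩
    have k4 : ent p (Finset.univ : Finset (Fin n)).restrict = ent p id :=
      ent_congr fun x y _ _ => by simp [funext_iff]
    have k5 := ent_condDouble_id hp.1 (W.restrict : (∀ i, D i) → _)
    change ent q id = _ at k5
    rw [k1, k2, k3, k5] at key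
    rw [k4]
    linarith

end Entropic


/-! ### Inequalities for four variables -/

/-- The conditional mutual information `I_h(B;D|C)`. -/
noncomputable def infoBD (h : Finset (Fin 4) → ℝ) : ℝ := CondIndepStmt.value h ⟨{1}, {3}, {2}⟩

lemma antecedentValue_sigmaABCD (h : Finset (Fin 4) → ℝ) :
    antecedentValue h sigmaABCD =
      (h {0, 2} + h {0, 3} - h {0, 2, 3} - h {0}) + (h {1, 2} + h {1, 3} - h {1, 2, 3} - h {1}) +
      (h {0} + h {1} - h {0, 1} - h ∅) + (h {1, 3} + h {2, 3} - h {1, 2, 3} - h {3}) := by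
  rw [antecedentValue, sigmaABCD, Finset.sum_insert (by decide), Finset.sum_insert (by decide),
    Finset.sum_insert (by decide), Finset.sum_singleton]
  simp only [CondIndepStmt.value]
  rw [show ({0} ∪ {2} : Finset (Fin 4)) = {0, 2} by decide,
    show ({0} ∪ {3} : Finset (Fin 4)) = {0, 3} by decide,
    show ({0, 2} ∪ {3} : Finset (Fin 4)) = {0, 2, 3} by decide,
    show ({1} ∪ {2} : Finset (Fin 4)) = {1, 2} by decide,
    show ({1} ∪ {3} : Finset (Fin 4)) = {1, 3} by decide,
    show ({1, 2} ∪ {3} : Finset (Fin 4)) = {1, 2, 3} by decide,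
    show (∅ ∪ {0} : Finset (Fin 4)) = {0} by decide,
    show (∅ ∪ {1} : Finset (Fin 4)) = {1} by decide,
    show ({0} ∪ {1} : Finset (Fin 4)) = {0, 1} by decide,
    show ({3} ∪ {1} : Finset (Fin 4)) = {1, 3} by decide,
    show ({3} ∪ {2} : Finset (Fin 4)) = {2, 3} by decide,
    show ({1, 3} ∪ {2} : Finset (Fin 4)) = {1, 2, 3} by decide]
  ring

lemma value_tauABCD (h : Finset (Fin 4) → ℝ) :
    tauABCD.value h = h {2} + h {3} - h {2, 3} - h ∅ := by
  simp only [CondIndepStmt.value, tauABCD]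
  rw [show (∅ ∪ {2} : Finset (Fin 4)) = {2} by decide,
    show (∅ ∪ {3} : Finset (Fin 4)) = {3} by decide,
    show ({2} ∪ {3} : Finset (Fin 4)) = {2, 3} by decide]

lemma infoBD_eq (h : Finset (Fin 4) → ℝ) :
    infoBD h = h {1, 2} + h {2, 3} - h {1, 2, 3} - h {2} := by
  simp only [CondIndepStmt.value, infoBD]
  rw [show ({2} ∪ {1} : Finset (Fin 4)) = {1, 2} by decide,
    show ({2} ∪ {3} : Finset (Fin 4)) = {2, 3} by decide,
    show ({1, 2} ∪ {3} : Finset (Fin 4)) = {1, 2, 3} by decide]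

/-- Replacing `D` by a copy of `B` over `C, D` decreases `I(B;D|C)` by `I(C;D)`, up to errors that
are bounded in terms of `h(Σ)`. -/
lemma exists_smaller_infoBD {h : Finset (Fin 4) → ℝ} (hh : h ∈ entropicFunctions 4) :
    ∃ h' ∈ entropicFunctions 4, antecedentValue h' sigmaABCD ≤ 4 * antecedentValue h sigmaABCD ∧
      tauABCD.value h ≤ tauABCD.value h' + antecedentValue h sigmaABCD ∧
      infoBD h' + tauABCD.value h ≤ infoBD h + 4 * antecedentValue h sigmaABCD := by
  obtain ⟨g, hg, g1, g2, g3⟩ := exists_copy hh {2, 3} 1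
  -- Index 4 is the copy B' of B; it takes the place of D, which is index 3.
  refine ⟨_, entropic_comap hg ![0, 1, 2, 4], ?_⟩
  have sub {α β γ δ : Finset (Fin 5)} (h1 : α ∪ β = γ) (h2 : α ∩ β = δ) :
      g γ + g δ ≤ g α + g β := by
    rw [← h1, ← h2]
    exact entropic_submodular hg α β
  have low {α : Finset (Fin 4)} {β : Finset (Fin 5)} (h1 : α.map Fin.castSuccEmb = β) :
      h α = g β := by
    rw [← h1, g1]
  have top {α γ : Finset (Fin 4)} {β : Finset (Fin 5)} (h0 : α ⊆ {2, 3})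
      (h1 : insert 4 (α.map Fin.castSuccEmb) = β) (h2 : insert 1 α = γ) : g β = h γ := by
    rw [← h1, ← h2]
    exact g2 α h0
  have im {α : Finset (Fin 4)} {β : Finset (Fin 5)} (h1 : α.image ![0, 1, 2, 4] = β) :
      g (α.image ![0, 1, 2, 4]) = g β := by
    rw [h1]
  rw [antecedentValue_sigmaABCD, antecedentValue_sigmaABCD, value_tauABCD, value_tauABCD,
    infoBD_eq, infoBD_eq]
  rw [@im {0, 2} {0, 2} (by decide), @im {0, 3} {0, 4} (by decide),
    @im {0, 2, 3} {0, 2, 4} (by decide), @im {0} {0} (by decide),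
    @im {1, 2} {1, 2} (by decide), @im {1, 3} {1, 4} (by decide),
    @im {1, 2, 3} {1, 2, 4} (by decide), @im {1} {1} (by decide), @im {0, 1} {0, 1} (by decide),
    @im {2, 3} {2, 4} (by decide), @im {3} {4} (by decide), @im {2} {2} (by decide),
    @im ∅ ∅ (by decide)]
  have c1 := @top ∅ {1} {4} (by decide) (by decide) (by decide)
  have c2 := @top {2} {1, 2} {2, 4} (by decide) (by decide) (by decide)
  have c3 := @top {3} {1, 3} {3, 4} (by decide) (by decide) (by decide)
  have c4 := @top {2, 3} {1, 2, 3} {2, 3, 4} (by decide) (by decide) (by decide)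
  have c5 : h {0, 1, 2, 3} + h {1, 2, 3} ≤ g {0, 1, 2, 3, 4} + h {2, 3} := by
    rw [show (Finset.univ : Finset (Fin 4)) = {0, 1, 2, 3} by decide,
      show (Finset.univ : Finset (Fin (4 + 1))) = {0, 1, 2, 3, 4} by decide] at g3
    exact g3
  rw [@low {0} {0} (by decide), @low {1} {1} (by decide), @low {2} {2} (by decide),
    @low {3} {3} (by decide), @low {0, 1} {0, 1} (by decide), @low {0, 2} {0, 2} (by decide),
    @low {0, 3} {0, 3} (by decide), @low {1, 2} {1, 2} (by decide),
    @low {1, 3} {1, 3} (by decide), @low {2, 3} {2, 3} (by decide),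
    @low {0, 2, 3} {0, 2, 3} (by decide), @low {1, 2, 3} {1, 2, 3} (by decide), @low ∅ ∅ (by decide)]
  rw [@low {1} {1} (by decide)] at c1
  rw [@low {1, 2} {1, 2} (by decide)] at c2
  rw [@low {1, 3} {1, 3} (by decide)] at c3
  rw [@low {1, 2, 3} {1, 2, 3} (by decide)] at c4 c5
  rw [@low {2, 3} {2, 3} (by decide), @low {0, 1, 2, 3} {0, 1, 2, 3} (by decide)] at c5
  -- nonnegativity of the terms of `h(Σ)`
  have a1 := @sub {0, 2} {0, 3} {0, 2, 3} {0} (by decide) (by decide)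
  have a2 := @sub {1, 2} {1, 3} {1, 2, 3} {1} (by decide) (by decide)
  have a3 := @sub {0} {1} {0, 1} ∅ (by decide) (by decide)
  have a4 := @sub {1, 3} {2, 3} {1, 2, 3} {3} (by decide) (by decide)
  -- conditional independence of the copy
  have d0 := @sub {0, 1, 2, 3} {0, 2, 3, 4} {0, 1, 2, 3, 4} {0, 2, 3} (by decide) (by decide)
  have d1 := @sub {0, 1, 2, 3} {1, 2, 3, 4} {0, 1, 2, 3, 4} {1, 2, 3} (by decide) (by decide)
  -- `b1`, `b2` and `d0` give I(C;B'|A) ≤ I(C;D|A) + I(B;C|D); `b3`, `b4` and `d1` give I(C;B'|B) ≤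
  -- I(C;D|B) + I(B;C|D). Moreover I(B;C|B') = I(C;B'|B), because B'C has the entropies of BC.
  have b1 := @sub {0, 3, 4} {0, 2, 4} {0, 2, 3, 4} {0, 4} (by decide) (by decide)
  have b2 := @sub {0, 3} {3, 4} {0, 3, 4} {3} (by decide) (by decide)
  have b3 := @sub {1, 3, 4} {1, 2, 4} {1, 2, 3, 4} {1, 4} (by decide) (by decide)
  have b4 := @sub {1, 3} {3, 4} {1, 3, 4} {3} (by decide) (by decide)
  -- `b5` bounds H(B'|AC) by H(B'|C), `b6` is I(A;B|B') ≥ 0, and `b7` with `c5` gives H(B'|AB) ≥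
  -- H(B'|CD). Together with the bound on I(C;B'|A) they yield I(B;B') ≤ I(B;D|C) up to h(Σ).
  have b5 := @sub {0, 2} {2, 4} {0, 2, 4} {2} (by decide) (by decide)
  have b6 := @sub {0, 4} {1, 4} {0, 1, 4} {4} (by decide) (by decide)
  have b7 := @sub {0, 1, 4} {0, 1, 2, 3} {0, 1, 2, 3, 4} {0, 1} (by decide) (by decide)
  have b8 := @sub {1, 2} {2, 4} {1, 2, 4} {2} (by decide) (by decide)
  refine ⟨by linarith, by linarith, by linarith⟩

lemma infoBD_nonneg {h : Finset (Fin 4) → ℝ} (hh : h ∈ entropicFunctions 4) : 0 ≤ infoBD h := by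
  have := entropic_submodular hh {1, 2} {2, 3}
  rw [show ({1, 2} ∪ {2, 3} : Finset (Fin 4)) = {1, 2, 3} by decide,
    show ({1, 2} ∩ {2, 3} : Finset (Fin 4)) = {2} by decide] at this
  rw [infoBD_eq]
  linarith

/-- An infinite family of information inequalities of Matúš type. -/
lemma exists_mul_tau_le (k : ℕ) : ∃ c : ℝ, 0 ≤ c ∧ ∀ h ∈ entropicFunctions 4,
    k * tauABCD.value h ≤ c * antecedentValue h sigmaABCD + infoBD h := by
  induction k with
  | zero => exact ⟨0, le_rfl, fun h hh => by simpa using infoBD_nonneg hh⟩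
  | succ k ih =>
    obtain ⟨c, hc, H⟩ := ih
    -- Apply the case k to `h'`: c * 4 pays for h'(Σ) ≤ 4h(Σ), k for the k-fold loss in I(C;D), and
    -- 4 for the error in the decrease of I(B;D|C).
    refine ⟨c * 4 + k + 4, by positivity, fun h hh => ?_⟩
    obtain ⟨h', hh', h1, h2, h3⟩ := exists_smaller_infoBD hh
    have := H h' hh'
    have := mul_le_mul_of_nonneg_left h1 hc
    have := mul_le_mul_of_nonneg_left h2 k.cast_nonneg (α := ℝ)
    push_cast
    linarith

/-! ### Passage to the closure and the exact implication -/

lemma continuous_value {n : ℕ} (σ : CondIndepStmt n) : Continuous fun h => σ.value h := by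
  unfold CondIndepStmt.value
  fun_prop

lemma continuous_antecedentValue {n : ℕ} (S : Finset (CondIndepStmt n)) :
    Continuous fun h => antecedentValue h S :=
  continuous_finsetSum _ fun σ _ => continuous_value σ

lemma almostEntropic_submodular {n : ℕ} {h : Finset (Fin n) → ℝ}
    (hh : h ∈ almostEntropicFunctions n) (α β : Finset (Fin n)) :
    h (α ∪ β) + h (α ∩ β) ≤ h α + h β :=
  closure_minimal (fun _ hg => entropic_submodular hg α β)
    (isClosed_le (f := fun h : Finset (Fin n) → ℝ => h (α ∪ β) + h (α ∩ β))
      (g := fun h => h α + h β) (by fun_prop) (by fun_prop)) hh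

/-- The implication itself need not survive limits, since h(Σ) = 0 may hold only in the limit; the
inequalities for fixed k do survive. -/
theorem exactImplication_almostEntropic :
    ExactImplication (almostEntropicFunctions 4) sigmaABCD tauABCD := by
  intro h hh h0
  have main (k : ℕ) : k * tauABCD.value h ≤ infoBD h := by
    obtain ⟨c, -, H⟩ := exists_mul_tau_le k
    have : k * tauABCD.value h ≤ c * antecedentValue h sigmaABCD + infoBD h :=
      closure_minimal H (isClosed_le (continuous_const.mul (continuous_value _))
        ((continuous_const.mul (continuous_antecedentValue _)).add (continuous_value _))) hh
    simpa [h0] using this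
  refine le_antisymm ?_ ?_
  · by_contra! hpos
    obtain ⟨k, hk⟩ := exists_nat_gt (infoBD h / tauABCD.value h)
    rw [div_lt_iff₀ hpos] at hk
    exact (main k).not_gt hk
  · have := almostEntropic_submodular hh {2} {3}
    rw [show ({2} ∪ {3} : Finset (Fin 4)) = {2, 3} by decide,
      show ({2} ∩ {3} : Finset (Fin 4)) = ∅ by decide] at this
    rw [value_tauABCD]
    linarith


/-! ### The Kaced–Romashchenko distribution -/

lemma sum_kacedRomashchenko_mul (ε : ℝ) (φ : (Fin 4 → Fin 2) → ℝ) :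
    ∑ x, kacedRomashchenko ε x * φ x = (1 / 2 - ε) * φ ![0, 0, 0, 0] +
      (1 / 2 - ε) * φ ![0, 1, 0, 1] + ε * φ ![1, 0, 1, 0] + ε * φ ![1, 1, 0, 0] := by
  have split (x) : kacedRomashchenko ε x * φ x =
      (if x = ![0, 0, 0, 0] then (1 / 2 - ε) * φ x else 0) +
      (if x = ![0, 1, 0, 1] then (1 / 2 - ε) * φ x else 0) +
      (if x = ![1, 0, 1, 0] then ε * φ x else 0) +
      (if x = ![1, 1, 0, 0] then ε * φ x else 0) := by
    unfold kacedRomashchenko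
    by_cases h1 : x = ![0, 0, 0, 0]
    · simp [h1]
    by_cases h2 : x = ![0, 1, 0, 1]
    · simp [h2]
    by_cases h3 : x = ![1, 0, 1, 0]
    · simp [h3]
    by_cases h4 : x = ![1, 1, 0, 0]
    · simp [h4]
    simp [h1, h2, h3, h4]
  simp only [split, Finset.sum_add_distrib, Finset.sum_ite_eq', Finset.mem_univ, if_true]

lemma kacedRomashchenko_mem_stdSimplex {ε : ℝ} (h0 : 0 ≤ ε) (h1 : ε ≤ 1 / 2) :
    kacedRomashchenko ε ∈ stdSimplex ℝ (Fin 4 → Fin 2) := by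
  refine ⟨fun x => ?_, ?_⟩
  · unfold kacedRomashchenko
    split_ifs <;> linarith
  · have := sum_kacedRomashchenko_mul ε fun _ => 1
    simp only [mul_one] at this
    rw [this]
    ring

lemma mass_kacedRomashchenko (ε : ℝ) (α : Finset (Fin 4)) (y : Fin 4 → Fin 2) :
    mass (kacedRomashchenko ε) α.restrict (α.restrict y) =
      (if ∀ i ∈ α, ![0, 0, 0, 0] i = y i then 1 / 2 - ε else 0) +
      (if ∀ i ∈ α, ![0, 1, 0, 1] i = y i then 1 / 2 - ε else 0) +
      (if ∀ i ∈ α, ![1, 0, 1, 0] i = y i then ε else 0) +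
      (if ∀ i ∈ α, ![1, 1, 0, 0] i = y i then ε else 0) := by
  classical
  have := sum_kacedRomashchenko_mul ε fun x => if ∀ i ∈ α, x i = y i then 1 else 0
  simp only [mul_ite, mul_one, mul_zero] at this
  rw [← this, mass_eq_sum_ite]
  simp only [agree_iff]

lemma ent_kacedRomashchenko (ε : ℝ) (α : Finset (Fin 4)) :
    ent (kacedRomashchenko ε) (α.restrict (π := fun _ => Fin 2)) =
      -((1 / 2 - ε) * Real.log (mass (kacedRomashchenko ε) α.restrict (α.restrict ![0, 0, 0, 0])) +
      (1 / 2 - ε) * Real.log (mass (kacedRomashchenko ε) α.restrict (α.restrict ![0, 1, 0, 1])) +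
      ε * Real.log (mass (kacedRomashchenko ε) α.restrict (α.restrict ![1, 0, 1, 0])) +
      ε * Real.log (mass (kacedRomashchenko ε) α.restrict (α.restrict ![1, 1, 0, 0]))) := by
  rw [ent, sum_kacedRomashchenko_mul ε fun x =>
    Real.log (mass (kacedRomashchenko ε) α.restrict (α.restrict x))]

/-- Only I(B;C|D) contributes: A and B are independent, and given any value of A or of B one of C, D
is constant. -/
lemma antecedentValue_kacedRomashchenko {ε : ℝ} (h0 : 0 < ε) (hε : ε < 1 / 2) :
    antecedentValue (entropyVector (kacedRomashchenko ε)) sigmaABCD * Real.log 2 =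
      2 * Real.negMulLog (1 / 2) - Real.negMulLog (1 / 2 - ε) - Real.negMulLog (1 / 2 + ε) := by
  have h2 : Real.log 2 ≠ 0 := (Real.log_pos one_lt_two).ne'
  have h1 : (2⁻¹ - ε + (2⁻¹ - ε) + ε + ε : ℝ) = 1 := by ring
  have e1 : Real.log (ε + ε) = Real.log 2 + Real.log ε := by
    rw [← two_mul, Real.log_mul two_ne_zero h0.ne']
  have e2 : Real.log (2⁻¹ - ε + (2⁻¹ - ε)) = Real.log 2 + Real.log (2⁻¹ - ε) := by
    rw [← two_mul, Real.log_mul two_ne_zero (by linarith)]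
  rw [antecedentValue_sigmaABCD]
  simp only [entropyVector_eq, add_mul, sub_mul, div_mul_cancel₀ _ h2, ent_kacedRomashchenko,
    mass_kacedRomashchenko, Real.negMulLog]
  simp [h1, e1, e2]
  ring

lemma value_tauABCD_kacedRomashchenko (ε : ℝ) :
    tauABCD.value (entropyVector (kacedRomashchenko ε)) * Real.log 2 =
      Real.negMulLog (1 - ε) + Real.negMulLog (1 / 2 + ε) - Real.negMulLog (1 / 2) := by
  have h2 : Real.log 2 ≠ 0 := (Real.log_pos one_lt_two).ne'
  have h3 : (2⁻¹ - ε + (2⁻¹ - ε) + ε : ℝ) = 1 - ε := by ring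
  rw [value_tauABCD]
  simp only [entropyVector_eq, add_mul, sub_mul, div_mul_cancel₀ _ h2, ent_kacedRomashchenko,
    mass_kacedRomashchenko, Real.negMulLog]
  simp [h3]
  ring

/-- The value is the gap between log 2 and the entropy of a coin of bias ε, so the first-order terms
cancel by symmetry. -/
lemma antecedentValue_kacedRomashchenko_le {ε : ℝ} (h0 : 0 < ε) (h1 : ε < 1 / 2) :
    antecedentValue (entropyVector (kacedRomashchenko ε)) sigmaABCD * Real.log 2 ≤ 4 * ε ^ 2 := by
  rw [antecedentValue_kacedRomashchenko h0 h1]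
  have e1 : Real.log (1 / 2 - ε) = Real.log (1 - 2 * ε) - Real.log 2 := by
    rw [← Real.log_div (by linarith) two_ne_zero]
    ring_nf
  have e2 : Real.log (1 / 2 + ε) = Real.log (1 + 2 * ε) - Real.log 2 := by
    rw [← Real.log_div (by linarith) two_ne_zero]
    ring_nf
  have l1 := Real.log_le_sub_one_of_pos (x := 1 - 2 * ε) (by linarith)
  have l2 := Real.log_le_sub_one_of_pos (x := 1 + 2 * ε) (by linarith)
  have m1 := mul_le_mul_of_nonneg_left l1 (show 0 ≤ 1 / 2 - ε by linarith)
  have m2 := mul_le_mul_of_nonneg_left l2 (show 0 ≤ 1 / 2 + ε by linarith)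
  simp only [Real.negMulLog, e1, e2]
  rw [one_div, Real.log_inv]
  linarith

/-- The event C = 1 has mass ε and forces D = 0, which reveals about one bit on D; hence the linear
term. -/
lemma le_value_tauABCD_kacedRomashchenko {ε : ℝ} (h0 : 0 < ε) (h1 : ε < 1 / 2) :
    ε * Real.log 2 - 3 * ε ^ 2 ≤
      tauABCD.value (entropyVector (kacedRomashchenko ε)) * Real.log 2 := by
  rw [value_tauABCD_kacedRomashchenko]
  have e2 : Real.log (1 / 2 + ε) = Real.log (1 + 2 * ε) - Real.log 2 := by
    rw [← Real.log_div (by linarith) two_ne_zero]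
    ring_nf
  have l1 := Real.log_le_sub_one_of_pos (x := 1 - ε) (by linarith)
  have l2 := Real.log_le_sub_one_of_pos (x := 1 + 2 * ε) (by linarith)
  have m1 := mul_le_mul_of_nonneg_left l1 (show 0 ≤ 1 - ε by linarith)
  have m2 := mul_le_mul_of_nonneg_left l2 (show 0 ≤ 1 / 2 + ε by linarith)
  simp only [Real.negMulLog, e2]
  rw [one_div, Real.log_inv]
  linarith

lemma antecedentValue_nonneg {h : Finset (Fin 4) → ℝ} (hh : h ∈ entropicFunctions 4) :
    0 ≤ antecedentValue h sigmaABCD := by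
  have sub {α β γ δ : Finset (Fin 4)} (h1 : α ∪ β = γ) (h2 : α ∩ β = δ) :
      h γ + h δ ≤ h α + h β := by
    rw [← h1, ← h2]
    exact entropic_submodular hh α β
  have a1 := @sub {0, 2} {0, 3} {0, 2, 3} {0} (by decide) (by decide)
  have a2 := @sub {1, 2} {1, 3} {1, 2, 3} {1} (by decide) (by decide)
  have a3 := @sub {0} {1} {0, 1} ∅ (by decide) (by decide)
  have a4 := @sub {1, 3} {2, 3} {1, 2, 3} {3} (by decide) (by decide)
  rw [antecedentValue_sigmaABCD]
  linarith

theorem entropic_failure (lam : ℝ) : ∃ ε₀ : ℝ, 0 < ε₀ ∧ ε₀ ≤ 1 / 2 ∧ ∀ ε : ℝ, 0 < ε → ε < ε₀ →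
    entropyVector (kacedRomashchenko ε) ∈ entropicFunctions 4 ∧
    lam * antecedentValue (entropyVector (kacedRomashchenko ε)) sigmaABCD <
      tauABCD.value (entropyVector (kacedRomashchenko ε)) := by
  have h2 : 0 < Real.log 2 := Real.log_pos one_lt_two
  -- The threshold is where |lam| * 4ε² meets ε log 2 - 3ε². The absolute value admits negative
  -- `lam`, as h(Σ) ≥ 0.
  refine ⟨min (1 / 2) (Real.log 2 / (4 * |lam| + 3)), by positivity, min_le_left _ _,
    fun ε h0 hε => ?_⟩
  obtain ⟨hhalf, hlog⟩ := lt_min_iff.1 hε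
  have mem : entropyVector (kacedRomashchenko ε) ∈ entropicFunctions 4 :=
    ⟨_, inferInstance, _, kacedRomashchenko_mem_stdSimplex h0.le hhalf.le, rfl⟩
  refine ⟨mem, lt_of_mul_lt_mul_right ?_ h2.le⟩
  rw [lt_div_iff₀ (by positivity)] at hlog
  calc lam * antecedentValue (entropyVector (kacedRomashchenko ε)) sigmaABCD * Real.log 2
      ≤ |lam| * (antecedentValue (entropyVector (kacedRomashchenko ε)) sigmaABCD * Real.log 2) := by
        rw [mul_assoc]
        exact mul_le_mul_of_nonneg_right (le_abs_self _)
          (mul_nonneg (antecedentValue_nonneg mem) h2.le)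
    _ ≤ |lam| * (4 * ε ^ 2) :=
        mul_le_mul_of_nonneg_left (antecedentValue_kacedRomashchenko_le h0 hhalf) (abs_nonneg _)
    _ < ε * Real.log 2 - 3 * ε ^ 2 := by
        have := mul_lt_mul_of_pos_left hlog h0
        linarith
    _ ≤ _ := le_value_tauABCD_kacedRomashchenko h0 hhalf

theorem theorem5p1 :
    ExactImplication (almostEntropicFunctions 4) sigmaABCD tauABCD ∧
    ¬ ApproxImplication (almostEntropicFunctions 4) sigmaABCD tauABCD ∧
    ∀ lam : ℝ, ∃ ε₀ : ℝ, 0 < ε₀ ∧ ε₀ ≤ 1 / 2 ∧ ∀ ε : ℝ, 0 < ε → ε < ε₀ →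
      entropyVector (kacedRomashchenko ε) ∈ entropicFunctions 4 ∧
      lam * antecedentValue (entropyVector (kacedRomashchenko ε)) sigmaABCD <
        tauABCD.value (entropyVector (kacedRomashchenko ε)) := by
  refine ⟨exactImplication_almostEntropic, ?_, entropic_failure⟩
  rintro ⟨lam, -, H⟩
  obtain ⟨ε₀, h0, -, hlt⟩ := entropic_failure lam
  obtain ⟨mem, lt⟩ := hlt (ε₀ / 2) (half_pos h0) (half_lt_self h0)
  exact (H _ (subset_closure mem)).not_gt lt
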